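/- **Conventions.** A compact quantum group is a pair $\mathbb{H}=(C(\mathbb{H}),\Delta)$, where $C(\mathbb{H})$ is a unital $C^*$-algebra and $\Delta\colon C(\mathbb{H})\to C(\mathbb{H})\otimes_{\min}C(\mathbb{H})$ is a unital $*$-homomorphism with $(\Delta\otimes\mathrm{id})\Delta=(\mathrm{id}\otimes\Delta)\Delta$ such that the linear spans of $(C(\mathbb{H})\otimes 1)\Delta(C(\mathbb{H}))$ and $(1\otimes C(\mathbb{H}))\Delta(C(\mathbb{H}))$ are dense; it is of Kac type if its Haar state is a trace. All representations are finite dimensional and unitary. $\operatorname{Irr}(\mathbb{H})$ is the set of equivalence classes of irreducible representations, and for every $x\in\operatorname{Irr}(\mathbb{H})$ a representation $u^x\in B(H_x)\otimes C(\mathbb{H})$ in the class $x$ is chosen and fixed; $\dim x=\dim H_x$. Let $c_c(\widehat{\mathbb{H}})=\bigoplus_{x}B(H_x)$ (algebraic direct sum), let $p_x$ be the central projection onto the block $B(H_x)$, and for $a=(a_x)_x\in c_c(\widehat{\mathbb{H}})$ put $$\mathcal{F}(a)=\sum_{x}(\dim x)\,(\operatorname{Tr}_{H_x}\otimes\mathrm{id})\bigl(u^x(a_x\otimes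 1)\bigr)\in C(\mathbb{H}),\qquad \|a\|_0^2=\sum_{x}(\dim x)\operatorname{Tr}_{H_x}(a_x^*a_x).$$ A length function on $\widehat{\mathbb{H}}$ is a map $l\colon\operatorname{Irr}(\mathbb{H})\to\mathbb{R}_{\ge 0}$ with $l(\varepsilon)=0$ for the trivial representation $\varepsilon$, $l(\overline{x})=l(x)$ for all $x$, and $l(z)\le l(x)+l(y)$ whenever $z\subseteq x\otimes y$. For $k\in\mathbb{N}=\{0,1,2,\dots\}$ let $Q_{l,k}=\sum_{x:\,l(x)<k+1}p_x$. For a length function $l$ and $P\in\mathbb{R}[X]$ we say that $(l,P)$ satisfies (RD) if $$\forall k\in\mathbb{N},\ \forall a\in Q_{l,k}\,c_c(\widehat{\mathbb{H}}):\quad \|\mathcal{F}(a)\|_{C(\mathbb{H})}\le P(k)\,\|a\|_0 .$$ An automorphism $\theta$ of $\mathbb{H}$ is a $*$-automorphism of $C(\mathbb{H})$ with $\Delta\theta=(\theta\otimes\theta)\Delta$; it acts on $\operatorname{Irr}(\mathbb{H})$ by $\theta_*[u]=[(\mathrm{id}\otimes\theta)(u)]$. For a group $\Theta$ of automorphisms,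 $l$ is $\Theta$-invariant if $l\circ\theta_*=l$ for all $\theta\in\Theta$. **Proposition.** Let $\mathbb{H}=(C(\mathbb{H}),\Delta)$ be a compact quantum group of Kac type and $\Theta$ a finite subgroup of $\operatorname{Aut}(C(\mathbb{H}),\Delta)$. The following are equivalent. 1. There exist a length function $l$ on $\widehat{\mathbb{H}}$ and $P\in\mathbb{R}[X]$ such that $(l,P)$ satisfies (RD). 2. There exist a $\Theta$-invariant length function $l_\Theta$ on $\widehat{\mathbb{H}}$ and $Q\in\mathbb{R}[X]$ such that $(l_\Theta,Q)$ satisfies (RD). More precisely, if $l$ is a length function and $(l,P)$ satisfies (RD), then $$l_\Theta=\frac{1}{|\Theta|}\sum_{\theta\in\Theta}l\circ\theta_*$$ is a $\Theta$-invariant length function and $(l_\Theta,\sqrt{|\Theta|}\,P)$ satisfies (RD). -/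

import Mathlib

noncomputable section

open scoped TensorProduct ENNReal ComplexOrder

/-- The states of a unital C⋆-algebra: positive linear functionals `φ` with `φ 1 = 1`
(positivity refers to the order whose positive elements are the `star a * a`). -/
def CStarState (A : Type*) [CStarAlgebra A] : Type _ :=
  letI := CStarAlgebra.spectralOrder A
  {φ : A →ₚ[ℂ] ℂ // φ 1 = 1}

namespace CStarState

variable {A : Type*} [CStarAlgebra A]

/-- The underlying positive functional. -/
def toPos (φ : CStarState A) :
    letI := CStarAlgebra.spectralOrder A
    A →ₚ[ℂ] ℂ := φ.1

/-- The GNS Hilbert space of a state. -/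
def Space (φ : CStarState A) : Type _ :=
  letI := CStarAlgebra.spectralOrder A
  letI := CStarAlgebra.spectralOrderedRing A
  φ.toPos.GNS

variable (φ : CStarState A)

instance : NormedAddCommGroup φ.Space :=
  letI := CStarAlgebra.spectralOrder A
  letI := CStarAlgebra.spectralOrderedRing A
  inferInstanceAs (NormedAddCommGroup φ.toPos.GNS)

instance : InnerProductSpace ℂ φ.Space :=
  letI := CStarAlgebra.spectralOrder A
  letI := CStarAlgebra.spectralOrderedRing A
  inferInstanceAs (InnerProductSpace ℂ φ.toPos.GNS)

instance : CompleteSpace φ.Space :=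
  letI := CStarAlgebra.spectralOrder A
  letI := CStarAlgebra.spectralOrderedRing A
  inferInstanceAs (CompleteSpace φ.toPos.GNS)

/-- The GNS representation of a state. -/
def rep : A →⋆ₐ[ℂ] (φ.Space →L[ℂ] φ.Space) :=
  letI := CStarAlgebra.spectralOrder A
  letI := CStarAlgebra.spectralOrderedRing A
  φ.toPos.gnsStarAlgHom

instance : Nontrivial φ.Space := by
  let _ := CStarAlgebra.spectralOrder A
  let _ := CStarAlgebra.spectralOrderedRing A
  refine ⟨⟨((φ.toPos.toPreGNS 1 : φ.toPos.PreGNS) : φ.toPos.GNS), (0 : φ.toPos.GNS), fun h => ?_⟩⟩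
  have h1 : ‖((φ.toPos.toPreGNS 1 : φ.toPos.PreGNS) : φ.toPos.GNS)‖ = 0 := by rw [h]; exact norm_zero
  rw [UniformSpace.Completion.norm_coe, PositiveLinearMap.preGNS_norm_def] at h1
  have h2 : φ.toPos 1 = 1 := φ.2
  simp [h2] at h1

end CStarState

/-- The `ℓ^∞`-product of a family of nonzero unital C⋆-algebras. -/
abbrev lpInftyCStarAlgebra {I : Type*} (E : I → Type*) [∀ i, CStarAlgebra (E i)]
    [∀ i, Nontrivial (E i)] : CStarAlgebra (lp E ∞) where

/-- The closed unital ⋆-subalgebra generated by a subset of a unital C⋆-algebra. -/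
def closedAdjoin {R : Type*} [CStarAlgebra R] (s : Set R) : StarSubalgebra ℂ R :=
  (StarAlgebra.adjoin ℂ s).topologicalClosure

lemma mem_closedAdjoin {R : Type*} [CStarAlgebra R] {s : Set R} {x : R} (hx : x ∈ s) :
    x ∈ closedAdjoin s :=
  StarSubalgebra.le_topologicalClosure _ (StarAlgebra.subset_adjoin ℂ _ hx)

instance closedAdjoinCStarAlgebra {R : Type*} [CStarAlgebra R] (s : Set R) :
    CStarAlgebra (closedAdjoin s) :=
  haveI : IsClosed (closedAdjoin s : Set R) := StarSubalgebra.isClosed_topologicalClosure _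
  StarSubalgebra.cstarAlgebra (closedAdjoin s)

namespace MinTensor

variable {A B : Type*} [CStarAlgebra A] [CStarAlgebra B]

/-- The Hilbert space tensor product of two GNS spaces. -/
abbrev PairSpace (p : CStarState A × CStarState B) : Type _ :=
  UniformSpace.Completion (p.1.Space ⊗[ℂ] p.2.Space)

instance (p : CStarState A × CStarState B) : Nontrivial (PairSpace p) := by
  obtain ⟨x, hx⟩ := exists_ne (0 : p.1.Space)
  obtain ⟨y, hy⟩ := exists_ne (0 : p.2.Space)
  refine ⟨⟨((x ⊗ₜ[ℂ] y : p.1.Space ⊗[ℂ] p.2.Space) : PairSpace p), 0, fun h => ?_⟩⟩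
  have h1 := congrArg norm h
  rw [UniformSpace.Completion.norm_coe, TensorProduct.norm_tmul] at h1
  simp [hx, hy] at h1

/-- The operator `π_φ(a) ⊗ π_ψ(b)`. -/
def pairOp (p : CStarState A × CStarState B) (a : A) (b : B) : PairSpace p →L[ℂ] PairSpace p :=
  (TensorProduct.mapL (p.1.rep a) (p.2.rep b)).completion

variable (A B) in
/-- The `ℓ^∞`-product of the algebras `B(H_φ ⊗ H_ψ)` over all pairs of states. -/
def Ambient : Type _ :=
  lp (fun p : CStarState A × CStarState B => PairSpace p →L[ℂ] PairSpace p) ∞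

instance ambientCStarAlgebra : CStarAlgebra (Ambient A B) :=
  lpInftyCStarAlgebra fun p : CStarState A × CStarState B => PairSpace p →L[ℂ] PairSpace p

lemma norm_pairOp_le (p : CStarState A × CStarState B) (a : A) (b : B) :
    ‖pairOp p a b‖ ≤ ‖a‖ * ‖b‖ := by
  refine ContinuousLinearMap.opNorm_le_bound _ (by positivity) fun x => ?_
  induction x using UniformSpace.Completion.induction_on with
  | hp => exact isClosed_le (by fun_prop) (by fun_prop)
  | ih x =>
    rw [pairOp, ContinuousLinearMap.completion_apply_coe, UniformSpace.Completion.norm_coe,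
      UniformSpace.Completion.norm_coe]
    refine (ContinuousLinearMap.le_opNorm _ _).trans ?_
    gcongr
    refine (TensorProduct.norm_mapL_le _ _).trans ?_
    gcongr
    · exact NonUnitalStarAlgHom.norm_apply_le p.1.rep a
    · exact NonUnitalStarAlgHom.norm_apply_le p.2.rep b

/-- The family `(π_φ(a) ⊗ π_ψ(b))` over all pairs of states. -/
def ambientTmul (a : A) (b : B) : Ambient A B :=
  show lp (fun p : CStarState A × CStarState B => PairSpace p →L[ℂ] PairSpace p) ∞ from
  ⟨fun p => pairOp p a b, memℓp_infty ⟨‖a‖ * ‖b‖, by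
    rintro _ ⟨p, rfl⟩
    exact norm_pairOp_le p a b⟩⟩

lemma ambientTmul_one : ambientTmul (1 : A) (1 : B) = 1 := by
  refine lp.ext (funext fun p => ?_)
  change pairOp p 1 1 = 1
  ext x
  induction x using UniformSpace.Completion.induction_on with
  | hp => exact isClosed_eq (by fun_prop) (by fun_prop)
  | ih x =>
    rw [pairOp, ContinuousLinearMap.completion_apply_coe, map_one, map_one]
    change ((TensorProduct.mapL (.id ℂ _) (.id ℂ _) x : _) : PairSpace p) = _
    rw [TensorProduct.mapL_id_id]
    rfl

end MinTensor

/-- The minimal (spatial) tensor product of two unital C⋆-algebras: the closed ⋆-subalgebra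
generated by the elementary tensors `a ⊗ b = (π_φ(a) ⊗ π_ψ(b))`, where `φ`, `ψ` run through all
states, that is, the closure of the algebraic tensor product in the tensor product of the
universal (hence faithful) representations. -/
def MinTensor (A B : Type*) [CStarAlgebra A] [CStarAlgebra B] : Type _ :=
  closedAdjoin (Set.range fun q : A × B => MinTensor.ambientTmul q.1 q.2)

namespace MinTensor

variable {A B : Type*} [CStarAlgebra A] [CStarAlgebra B]

instance : CStarAlgebra (MinTensor A B) :=
  closedAdjoinCStarAlgebra (Set.range fun q : A × B => ambientTmul q.1 q.2)

/-- The elementary tensor `a ⊗ b`. -/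
def tmul (a : A) (b : B) : MinTensor A B :=
  ⟨ambientTmul a b, mem_closedAdjoin ⟨(a, b), rfl⟩⟩

lemma tmul_one : tmul (1 : A) (1 : B) = 1 := Subtype.ext ambientTmul_one

end MinTensor

/-- `D` is the tensor product `f ⊗ g` of two ⋆-homomorphisms, i.e. the (unique) ⋆-homomorphism
of the minimal tensor products with `a ⊗ b ↦ f a ⊗ g b`. -/
def IsTensorMap {A B A' B' : Type*} [CStarAlgebra A] [CStarAlgebra B] [CStarAlgebra A']
    [CStarAlgebra B'] (f : A →⋆ₐ[ℂ] A') (g : B →⋆ₐ[ℂ] B')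
    (D : MinTensor A B →⋆ₐ[ℂ] MinTensor A' B') : Prop :=
  ∀ a b, D (MinTensor.tmul a b) = MinTensor.tmul (f a) (g b)

/-- Coassociativity `(Δ ⊗ id)Δ = (id ⊗ Δ)Δ`; `α` is the canonical identification
`(A ⊗ A) ⊗ A = A ⊗ (A ⊗ A)`. -/
def IsCoassociative {A : Type*} [CStarAlgebra A] (Δ : A →⋆ₐ[ℂ] MinTensor A A) : Prop :=
  ∃ (D₁ : MinTensor A A →⋆ₐ[ℂ] MinTensor (MinTensor A A) A)
    (D₂ : MinTensor A A →⋆ₐ[ℂ] MinTensor A (MinTensor A A))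
    (α : MinTensor (MinTensor A A) A ≃⋆ₐ[ℂ] MinTensor A (MinTensor A A)),
    IsTensorMap Δ (StarAlgHom.id ℂ A) D₁ ∧ IsTensorMap (StarAlgHom.id ℂ A) Δ D₂ ∧
    (∀ a b c, α (MinTensor.tmul (MinTensor.tmul a b) c) =
      MinTensor.tmul a (MinTensor.tmul b c)) ∧
    ∀ a, α (D₁ (Δ a)) = D₂ (Δ a)

/-- A compact quantum group `ℍ = (C(ℍ), Δ)` in the sense of Woronowicz, with `A = C(ℍ)`. -/
structure CompactQuantumGroup (A : Type*) [CStarAlgebra A] where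
  /-- The comultiplication, a unital ⋆-homomorphism into the minimal tensor product. -/
  comul : A →⋆ₐ[ℂ] MinTensor A A
  coassoc : IsCoassociative comul
  dense_left : Dense (Submodule.span ℂ
    {t | ∃ a b, t = MinTensor.tmul a 1 * comul b} : Set (MinTensor A A))
  dense_right : Dense (Submodule.span ℂ
    {t | ∃ a b, t = MinTensor.tmul 1 a * comul b} : Set (MinTensor A A))

namespace CompactQuantumGroup

variable {A : Type*} [CStarAlgebra A] (H : CompactQuantumGroup A)

/-- `h` is the Haar state: a state with `(h ⊗ id)Δ(a) = h(a)1 = (id ⊗ h)Δ(a)`. The maps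
`E₁ = h ⊗ id` and `E₂ = id ⊗ h` are the (unique) continuous extensions of the slice maps. -/
def IsHaarState (h : A →ₗ[ℂ] ℂ) : Prop :=
  h 1 = 1 ∧ (∀ a, 0 ≤ h (star a * a)) ∧
  ∃ E₁ E₂ : MinTensor A A →L[ℂ] A,
    (∀ a b, E₁ (MinTensor.tmul a b) = h a • b) ∧
    (∀ a b, E₂ (MinTensor.tmul a b) = h b • a) ∧
    ∀ a, E₁ (H.comul a) = h a • 1 ∧ E₂ (H.comul a) = h a • 1

/-- Kac type: the Haar state is a trace. -/
def IsKac : Prop :=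
  ∃ h : A →ₗ[ℂ] ℂ, H.IsHaarState h ∧ ∀ a b, h (a * b) = h (b * a)

/-- A finite dimensional unitary representation, written as the matrix `u = (u i j)` of its
coefficients in an orthonormal basis: `u` is unitary and `Δ(u i j) = ∑ k, u i k ⊗ u k j`. -/
def IsUnitaryRep {ι : Type*} [Fintype ι] [DecidableEq ι] (u : Matrix ι ι A) : Prop :=
  u ∈ unitary (Matrix ι ι A) ∧
    ∀ i j, H.comul (u i j) = ∑ k, MinTensor.tmul (u i k) (u k j)

end CompactQuantumGroup

/-- The scalar matrix `T`, seen as the matrix `T ⊗ 1` over `A`. -/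
abbrev scalarMatrix (A : Type*) [CStarAlgebra A] {ι κ : Type*} (T : Matrix κ ι ℂ) :
    Matrix κ ι A :=
  T.map (algebraMap ℂ A)

/-- `T` intertwines `u` and `v`: `(T ⊗ 1) u = v (T ⊗ 1)`. -/
def IsIntertwiner {A : Type*} [CStarAlgebra A] {ι κ : Type*} [Fintype ι] [Fintype κ]
    (u : Matrix ι ι A) (v : Matrix κ κ A) (T : Matrix κ ι ℂ) : Prop :=
  scalarMatrix A T * u = v * scalarMatrix A T

namespace CompactQuantumGroup

variable {A : Type*} [CStarAlgebra A] (H : CompactQuantumGroup A)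

/-- An irreducible finite dimensional unitary representation. -/
structure IrrRep where
  dim : ℕ
  mat : Matrix (Fin dim) (Fin dim) A
  isRep : H.IsUnitaryRep mat
  dim_pos : 0 < dim
  irreducible : ∀ T : Matrix (Fin dim) (Fin dim) ℂ, IsIntertwiner mat mat T →
    ∃ c : ℂ, T = c • (1 : Matrix (Fin dim) (Fin dim) ℂ)

variable {H}

/-- Unitary equivalence of irreducible representations. -/
def IrrRep.Equivalent (u v : H.IrrRep) : Prop :=
  ∃ T : Matrix (Fin v.dim) (Fin u.dim) ℂ,
    T.conjTranspose * T = 1 ∧ T * T.conjTranspose = 1 ∧ IsIntertwiner u.mat v.mat T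

lemma scalarMatrix_mul {ι κ μ : Type*} [Fintype κ] (S : Matrix ι κ ℂ) (T : Matrix κ μ ℂ) :
    scalarMatrix A (S * T) = scalarMatrix A S * scalarMatrix A T :=
  Matrix.map_mul

lemma scalarMatrix_one {ι : Type*} [DecidableEq ι] :
    scalarMatrix A (1 : Matrix ι ι ℂ) = 1 :=
  Matrix.map_one _ (map_zero _) (map_one _)

variable (H) in
instance irrSetoid : Setoid H.IrrRep where
  r := IrrRep.Equivalent
  iseqv :=
    { refl := fun u => ⟨1, by simp, by simp, by simp [IsIntertwiner]⟩
      symm := by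
        rintro u v ⟨T, h₁, h₂, h⟩
        refine ⟨T.conjTranspose, by simpa using h₂, by simpa using h₁, ?_⟩
        unfold IsIntertwiner at h ⊢
        calc scalarMatrix A T.conjTranspose * v.mat
            = scalarMatrix A T.conjTranspose * (v.mat * scalarMatrix A T) *
                scalarMatrix A T.conjTranspose := by
              rw [Matrix.mul_assoc, Matrix.mul_assoc, ← scalarMatrix_mul, h₂, scalarMatrix_one,
                Matrix.mul_one]
          _ = u.mat * scalarMatrix A T.conjTranspose := by
              rw [← h, ← Matrix.mul_assoc, ← scalarMatrix_mul, h₁, scalarMatrix_one,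
                Matrix.one_mul]
      trans := by
        rintro u v w ⟨T, h₁, h₂, h⟩ ⟨S, k₁, k₂, k⟩
        refine ⟨S * T, ?_, ?_, ?_⟩
        · rw [Matrix.conjTranspose_mul, Matrix.mul_assoc, ← Matrix.mul_assoc _ S, k₁,
            Matrix.one_mul, h₁]
        · rw [Matrix.conjTranspose_mul, Matrix.mul_assoc, ← Matrix.mul_assoc T, h₂,
            Matrix.one_mul, k₂]
        · unfold IsIntertwiner at h k ⊢
          rw [scalarMatrix_mul, Matrix.mul_assoc, h, ← Matrix.mul_assoc, k, Matrix.mul_assoc] }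

variable (H) in
/-- `Irr(ℍ)`. -/
def Irr : Type _ := Quotient (irrSetoid H)

/-- The class of an irreducible representation. -/
def IrrRep.cls (u : H.IrrRep) : H.Irr := Quotient.mk (irrSetoid H) u

variable (H) in
/-- The trivial representation. -/
def trivialRep : H.IrrRep where
  dim := 1
  mat := 1
  isRep := ⟨one_mem _, fun i j => by
    rw [Subsingleton.elim i 0, Subsingleton.elim j 0]
    simp only [Matrix.one_apply_eq, map_one, Fin.sum_univ_one]
    exact MinTensor.tmul_one.symm⟩
  dim_pos := Nat.one_pos
  irreducible T _ := ⟨T 0 0, by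
    ext i j
    rw [Subsingleton.elim i 0, Subsingleton.elim j 0]
    simp⟩

/-- `v` is conjugate to `u`: it is equivalent to the contragredient `(star (u i j))`. -/
def IrrRep.IsConjugate (u v : H.IrrRep) : Prop :=
  ∃ (S : Matrix (Fin v.dim) (Fin u.dim) ℂ) (S' : Matrix (Fin u.dim) (Fin v.dim) ℂ),
    S * S' = 1 ∧ S' * S = 1 ∧ IsIntertwiner (u.mat.map star) v.mat S

/-- `w` is contained in the tensor product `u × v` (the matrix with entries
`u i j * v k l`): there is an isometric intertwiner. -/
def IrrRep.IsContainedInTensor (w u v : H.IrrRep) : Prop :=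
  ∃ V : Matrix (Fin u.dim × Fin v.dim) (Fin w.dim) ℂ,
    V.conjTranspose * V = 1 ∧ IsIntertwiner w.mat (Matrix.kronecker u.mat v.mat) V

/-- Length functions on the dual `ℍ^`. -/
structure IsLengthFunction (l : H.Irr → ℝ) : Prop where
  nonneg : ∀ x, 0 ≤ l x
  trivial : l H.trivialRep.cls = 0
  conj : ∀ u v : H.IrrRep, u.IsConjugate v → l u.cls = l v.cls
  tensor : ∀ u v w : H.IrrRep, w.IsContainedInTensor u v → l w.cls ≤ l u.cls + l v.cls

variable (H) in
/-- `θ` intertwines the comultiplication: `Δ ∘ θ = (θ ⊗ θ) ∘ Δ`. -/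
def Intertwines (θ : A ≃⋆ₐ[ℂ] A) : Prop :=
  ∃ D : MinTensor A A ≃⋆ₐ[ℂ] MinTensor A A,
    (∀ a b, D (MinTensor.tmul a b) = MinTensor.tmul (θ a) (θ b)) ∧
    ∀ a, H.comul (θ a) = D (H.comul a)

variable (H) in
/-- The automorphism group of the compact quantum group `(C(ℍ), Δ)`. -/
def aut : Subgroup (A ≃⋆ₐ[ℂ] A) where
  carrier := {θ | H.Intertwines θ}
  one_mem' := ⟨1, fun _ _ => rfl, fun _ => rfl⟩
  mul_mem' := by
    rintro θ σ ⟨D, hD, hD'⟩ ⟨E, hE, hE'⟩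
    refine ⟨D * E, fun a b => ?_, fun a => ?_⟩
    · change D (E _) = MinTensor.tmul (θ (σ a)) (θ (σ b))
      rw [hE, hD]
    · change H.comul (θ (σ a)) = D (E _)
      rw [hD', hE']
  inv_mem' := by
    rintro θ ⟨D, hD, hD'⟩
    refine ⟨D.symm, fun a b => ?_, fun a => ?_⟩
    · change D.symm _ = MinTensor.tmul (θ.symm a) (θ.symm b)
      rw [← D.symm_apply_apply (MinTensor.tmul (θ.symm a) (θ.symm b)), hD, θ.apply_symm_apply,
        θ.apply_symm_apply]
    · change H.comul (θ.symm a) = D.symm _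
      rw [← D.symm_apply_apply (H.comul (θ.symm a)), ← hD', θ.apply_symm_apply]

lemma scalarMatrix_map (θ : A ≃⋆ₐ[ℂ] A) {ι κ : Type*} (T : Matrix κ ι ℂ) :
    (scalarMatrix A T).map θ = scalarMatrix A T := by
  ext i j
  simp [scalarMatrix, Algebra.algebraMap_eq_smul_one]

lemma isIntertwiner_map (θ : A ≃⋆ₐ[ℂ] A) {ι κ : Type*} [Fintype ι] [Fintype κ]
    {u : Matrix ι ι A} {v : Matrix κ κ A} {T : Matrix κ ι ℂ} (h : IsIntertwiner u v T) :
    IsIntertwiner (u.map θ) (v.map θ) T := by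
  have := congrArg (fun M : Matrix κ ι A => M.map θ) h
  simpa only [Matrix.map_mul, scalarMatrix_map, IsIntertwiner] using this

/-- `θ_*(u) = (id ⊗ θ)(u)`. -/
def IrrRep.map (θ : H.aut) (u : H.IrrRep) : H.IrrRep where
  dim := u.dim
  mat := u.mat.map (θ : A ≃⋆ₐ[ℂ] A)
  isRep := by
    obtain ⟨θ, D, hD, hD'⟩ := θ
    obtain ⟨⟨h₁, h₂⟩, h₃⟩ := u.isRep
    have hs : star (u.mat.map θ) = (star u.mat).map θ := by
      ext i j
      simp [Matrix.star_apply, map_star]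
    refine ⟨⟨?_, ?_⟩, fun i j => ?_⟩
    · rw [hs, ← Matrix.map_mul, h₁]
      exact Matrix.map_one _ (map_zero _) (map_one _)
    · rw [hs, ← Matrix.map_mul, h₂]
      exact Matrix.map_one _ (map_zero _) (map_one _)
    · simp only [Matrix.map_apply, hD', h₃, map_sum, hD]
  dim_pos := u.dim_pos
  irreducible T hT := u.irreducible T <| by
    have := isIntertwiner_map (θ : A ≃⋆ₐ[ℂ] A).symm hT
    simpa [Matrix.map_map, Function.comp_def] using this

/-- The induced map `θ_* [u] = [θ_*(u)]` on `Irr(ℍ)`. -/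
def irrMap (θ : H.aut) : H.Irr → H.Irr :=
  Quotient.map (IrrRep.map θ) fun _ _ ⟨T, h₁, h₂, h⟩ =>
    ⟨T, h₁, h₂, isIntertwiner_map (θ : A ≃⋆ₐ[ℂ] A) h⟩

/-- `l` is invariant under a group `Θ` of automorphisms. -/
def IsInvariant (Θ : Subgroup H.aut) (l : H.Irr → ℝ) : Prop :=
  ∀ θ ∈ Θ, ∀ x, l (irrMap θ x) = l x

/-- The average `|Θ|⁻¹ ∑ l ∘ θ_*` of `l` over a finite group `Θ` of automorphisms. -/
def average (Θ : Subgroup H.aut) [Fintype Θ] (l : H.Irr → ℝ) : H.Irr → ℝ :=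
  fun x => (Fintype.card Θ : ℝ)⁻¹ * ∑ θ : Θ, l (irrMap θ.1 x)

variable (H) in
/-- A choice of a representation `u^x` in every class `x ∈ Irr(ℍ)`. -/
structure Representatives where
  rep : H.Irr → H.IrrRep
  cls_rep : ∀ x, (rep x).cls = x

namespace Representatives

variable (R : H.Representatives)

/-- `c_c(ℍ^)`, the algebraic direct sum of the full matrix algebras `B(H_x)`, where
`H_x = ℂ^(dim x)` is the space of `u^x`. -/
abbrev Cc : Type _ :=
  Π₀ x : H.Irr, Matrix (Fin (R.rep x).dim) (Fin (R.rep x).dim) ℂ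

open Classical in
/-- The Fourier transform `∑ x, (dim x) (Tr ⊗ id)(u^x (a p_x ⊗ 1))`. -/
def fourier (a : R.Cc) : A :=
  a.sum fun x m => ((R.rep x).dim : ℂ) • Matrix.trace ((R.rep x).mat * scalarMatrix A m)

open Classical in
/-- The Sobolev-0-norm, `‖a‖₀² = ∑ x, (dim x) Tr(a* a p_x)`. -/
def sobolevNorm (a : R.Cc) : ℝ :=
  Real.sqrt (a.sum fun x m =>
    ((R.rep x).dim : ℝ) * (Matrix.trace (m.conjTranspose * m)).re)

open Classical in
/-- Multiplication by the central projection `Q_{l,k} = ∑ p_x` over all `x` with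
`l x < k + 1`, on `c_c(ℍ^)`. -/
def cutoff (l : H.Irr → ℝ) (k : ℕ) (a : R.Cc) : R.Cc :=
  a.filter fun x => l x < k + 1

/-- `‖F(a)‖ ≤ P(k) ‖a‖₀` for all `k` and all `a ∈ Q_{l,k} c_c(ℍ^)`. -/
def RapidDecayBound (l : H.Irr → ℝ) (P : Polynomial ℝ) : Prop :=
  ∀ k : ℕ, ∀ a ∈ Set.range (R.cutoff l k),
    ‖R.fourier a‖ ≤ P.eval (k : ℝ) * R.sobolevNorm a

end Representatives

end CompactQuantumGroup

end

/-! An automorphism `θ` applied entrywise fixes scalar matrices, so it keeps intertwiners and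
carries the trivial representation, conjugates and tensor inclusions to the same data. Hence each `l
∘ θ_*` is a length function, and so is the average.

For rapid decay, suppose the average of `l` is below `k + 1` on the support of `a`. At each such `x`
some `l (θ_* x)` is below `k + 1` (`exists_lt_of_average_lt`), so `a` splits into `|Θ|` disjointly
supported pieces, the one for `θ` living where `l ∘ θ_* < k + 1`. Transport along `θ`
(`exists_transport`) moves that piece into the cutoff of `l`, preserves `‖·‖₀`, and turns its
Fourier transform into the image under `θ`, which has the same C⋆-norm. Each piece thus obeys the
original bound (`RapidDecayBound.norm_fourier_le`). The pieces are orthogonal for `‖·‖₀`, so summing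
by Cauchy–Schwarz costs the factor `√|Θ|`. -/

namespace CompactQuantumGroup

/-! ### Action of automorphisms on irreducible representations -/

variable {A : Type*} [CStarAlgebra A] {H : CompactQuantumGroup A}

lemma irrMap_one (x : H.Irr) : irrMap 1 x = x := by
  induction x using Quotient.inductionOn with
  | h u => rfl

lemma irrMap_mul (σ θ : H.aut) (x : H.Irr) : irrMap (σ * θ) x = irrMap σ (irrMap θ x) := by
  induction x using Quotient.inductionOn with
  | h u => rfl

/-- The action of an automorphism on `Irr(ℍ)`, as a permutation. -/
def irrEquiv (θ : H.aut) : H.Irr ≃ H.Irr where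
  toFun := irrMap θ
  invFun := irrMap θ⁻¹
  left_inv x := by rw [← irrMap_mul, inv_mul_cancel, irrMap_one]
  right_inv x := by rw [← irrMap_mul, mul_inv_cancel, irrMap_one]

/-- Transported elements are indexed by the target class `y`, hence the form with `θ⁻¹` inside. -/
lemma sum_map_irrEquiv {M : Type*} [AddCommMonoid M] (θ : H.aut) (s : Finset H.Irr)
    (f : H.Irr → M) :
    ∑ y ∈ s.map (irrEquiv θ).toEmbedding, f (irrMap θ⁻¹ y) = ∑ x ∈ s, f x := by
  rw [Finset.sum_map]
  exact Finset.sum_congr rfl fun x _ => congrArg f ((irrEquiv θ).left_inv x)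

lemma irrMap_cls (θ : H.aut) (u : H.IrrRep) : irrMap θ u.cls = (u.map θ).cls := rfl

lemma irrMap_trivialRep (θ : H.aut) : irrMap θ H.trivialRep.cls = H.trivialRep.cls := by
  rw [irrMap_cls]
  congr 1
  simp only [IrrRep.map, trivialRep]
  congr 1
  exact Matrix.map_one _ (map_zero _) (map_one _)

/-- The same `S` and `S'` serve, since `θ` fixes scalars and commutes with `star`. -/
lemma IrrRep.IsConjugate.map (θ : H.aut) {u v : H.IrrRep} (h : u.IsConjugate v) :
    (u.map θ).IsConjugate (v.map θ) := by
  obtain ⟨S, S', h₁, h₂, h⟩ := h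
  refine ⟨S, S', h₁, h₂, ?_⟩
  have hs : (u.map θ).mat.map star = (u.mat.map star).map (θ : A ≃⋆ₐ[ℂ] A) := by
    ext i j
    exact (map_star (θ : A ≃⋆ₐ[ℂ] A) (u.mat i j)).symm
  rw [hs]
  exact isIntertwiner_map _ h

lemma IrrRep.IsContainedInTensor.map (θ : H.aut) {w u v : H.IrrRep}
    (h : w.IsContainedInTensor u v) :
    (w.map θ).IsContainedInTensor (u.map θ) (v.map θ) := by
  obtain ⟨V, h₁, h⟩ := h
  refine ⟨V, h₁, ?_⟩
  have hk : Matrix.kronecker (u.map θ).mat (v.map θ).mat =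
      (Matrix.kronecker u.mat v.mat).map (θ : A ≃⋆ₐ[ℂ] A) := by
    ext i j
    exact (map_mul (θ : A ≃⋆ₐ[ℂ] A) (u.mat i.1 j.1) (v.mat i.2 j.2)).symm
  rw [hk]
  exact isIntertwiner_map _ h

/-! ### Averaging a length function -/

section Average

variable (Θ : Subgroup H.aut) [Fintype Θ] {l : H.Irr → ℝ}

lemma IsLengthFunction.average (hl : IsLengthFunction l) :
    IsLengthFunction (average Θ l) where
  nonneg x := mul_nonneg (by positivity) (Finset.sum_nonneg fun _ _ => hl.nonneg _)
  trivial := by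
    simp [CompactQuantumGroup.average, irrMap_trivialRep, hl.trivial]
  conj u v h := by
    simp only [CompactQuantumGroup.average, irrMap_cls]
    congr 1
    exact Finset.sum_congr rfl fun θ _ => hl.conj _ _ (h.map θ.1)
  tensor u v w h := by
    simp only [CompactQuantumGroup.average, irrMap_cls]
    rw [← mul_add, ← Finset.sum_add_distrib]
    gcongr with θ
    exact hl.tensor _ _ _ (h.map θ.1)

variable (l) in
lemma isInvariant_average : IsInvariant Θ (average Θ l) := by
  intro θ hθ x
  simp only [average]
  congr 1
  -- Right translation by `θ` permutes `Θ` and absorbs the inner `θ_*`.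
  refine Fintype.sum_equiv (Equiv.mulRight (⟨θ, hθ⟩ : Θ)) _ _ fun σ => ?_
  simp [irrMap_mul]

lemma exists_lt_of_average_lt {x : H.Irr} {c : ℝ} (h : average Θ l x < c) :
    ∃ θ : Θ, l (irrMap θ.1 x) < c := by
  by_contra! hc
  have hcard : (0 : ℝ) < Fintype.card Θ := by exact_mod_cast Fintype.card_pos
  have h₁ : (Fintype.card Θ : ℝ) * c ≤ ∑ θ : Θ, l (irrMap θ.1 x) := by
    simpa using Finset.card_nsmul_le_sum Finset.univ _ c fun θ _ => hc θ
  rw [average, inv_mul_lt_iff₀ hcard] at h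
  exact absurd h₁ h.not_ge

end Average

/-! ### Traces under change of representative -/

/-- Scalar matrices can be cycled out of the trace even if the entries do not commute. -/
lemma trace_scalarMatrix_mul_comm {ι κ : Type*} [Fintype ι] [Fintype κ] (T : Matrix κ ι ℂ)
    (M : Matrix ι κ A) :
    (scalarMatrix A T * M).trace = (M * scalarMatrix A T).trace := by
  simp only [Matrix.trace, Matrix.diag_apply, Matrix.mul_apply, Matrix.map_apply]
  rw [Finset.sum_comm]
  exact Finset.sum_congr rfl fun i _ => Finset.sum_congr rfl fun j _ => Algebra.commutes _ _

lemma trace_map_starAlgEquiv (θ : A ≃⋆ₐ[ℂ] A) {ι : Type*} [Fintype ι] (M : Matrix ι ι A) :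
    (M.map θ).trace = θ M.trace := by
  simp [Matrix.trace, map_sum]

/-- The intertwining relation moves `T` to the left of `u`. Cycling it to the far right then cancels
it against its adjoint. -/
lemma trace_mul_conj_of_isIntertwiner {ι κ : Type*} [Fintype ι] [DecidableEq ι] [Fintype κ]
    {u : Matrix ι ι A} {v : Matrix κ κ A} {T : Matrix κ ι ℂ}
    (hT : T.conjTranspose * T = 1) (h : IsIntertwiner u v T) (m : Matrix ι ι ℂ) :
    (v * scalarMatrix A (T * m * T.conjTranspose)).trace = (u * scalarMatrix A m).trace := by
  rw [Matrix.mul_assoc, scalarMatrix_mul, ← Matrix.mul_assoc, ← h, Matrix.mul_assoc,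
    trace_scalarMatrix_mul_comm, scalarMatrix_mul, Matrix.mul_assoc, Matrix.mul_assoc,
    ← scalarMatrix_mul, hT, scalarMatrix_one, Matrix.mul_one]

lemma trace_conjTranspose_mul_self_conj {ι κ : Type*} [Fintype ι] [DecidableEq ι] [Fintype κ]
    {T : Matrix κ ι ℂ} (hT : T.conjTranspose * T = 1) (m : Matrix ι ι ℂ) :
    ((T * m * T.conjTranspose).conjTranspose * (T * m * T.conjTranspose)).trace =
      (m.conjTranspose * m).trace := by
  have : (T * m * T.conjTranspose).conjTranspose * (T * m * T.conjTranspose) =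
      T * (m.conjTranspose * (T.conjTranspose * T) * m * T.conjTranspose) := by
    simp only [Matrix.conjTranspose_mul, Matrix.conjTranspose_conjTranspose, Matrix.mul_assoc]
  rw [this, hT, Matrix.mul_one, Matrix.trace_mul_comm, Matrix.mul_assoc, hT, Matrix.mul_one]

/-- Both dimensions are traces, of `T* T` and of `T T*`. -/
lemma IrrRep.Equivalent.dim_eq {u v : H.IrrRep} (h : u.Equivalent v) : u.dim = v.dim := by
  obtain ⟨T, h₁, h₂, -⟩ := h
  have := Matrix.trace_mul_comm T.conjTranspose T
  rw [h₁, h₂] at this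
  simpa using this

/-! ### Transport of finitely supported elements -/

namespace Representatives

variable (R : H.Representatives)

/-- The chosen representatives need not be permuted by `θ`; they match only up to equivalence, so
transport must conjugate by unitaries. -/
lemma map_rep_equivalent (θ : H.aut) (y : H.Irr) :
    ((R.rep (irrMap θ⁻¹ y)).map θ).Equivalent (R.rep y) := by
  refine Quotient.exact (?_ : ((R.rep (irrMap θ⁻¹ y)).map θ).cls = (R.rep y).cls)
  rw [← irrMap_cls, R.cls_rep, R.cls_rep]
  exact (irrEquiv θ).right_inv y

lemma dim_rep_irrMap_inv (θ : H.aut) (y : H.Irr) :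
    (R.rep (irrMap θ⁻¹ y)).dim = (R.rep y).dim :=
  (R.map_rep_equivalent θ y).dim_eq

/-- A unitary intertwiner between `θ_*(u^x)` and `u^y`, where `y = θ_* x`. -/
lemma exists_unitary_intertwiner (θ : H.aut) (y : H.Irr) :
    ∃ T : Matrix (Fin (R.rep y).dim) (Fin (R.rep (irrMap θ⁻¹ y)).dim) ℂ,
      T.conjTranspose * T = 1 ∧
      IsIntertwiner ((R.rep (irrMap θ⁻¹ y)).mat.map (θ : A ≃⋆ₐ[ℂ] A)) (R.rep y).mat T := by
  obtain ⟨T, h₁, _, h⟩ := R.map_rep_equivalent θ y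
  exact ⟨T, h₁, h⟩

open Classical in
-- Any finite set containing the support may index the sum, so elements with different supports can
-- be compared termwise.
lemma fourier_eq_sum_of_subset (a : R.Cc) {s : Finset H.Irr} (hs : ∀ x, a x ≠ 0 → x ∈ s) :
    R.fourier a = ∑ x ∈ s, ((R.rep x).dim : ℂ) •
      Matrix.trace ((R.rep x).mat * scalarMatrix A (a x)) := by
  refine Finset.sum_subset (fun x hx => hs x (DFinsupp.mem_support_iff.1 hx)) fun x _ hx => ?_
  rw [DFinsupp.notMem_support_iff.1 hx]
  simp [scalarMatrix]

open Classical in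
lemma sobolevNorm_eq_sqrt_sum_of_subset (a : R.Cc) {s : Finset H.Irr}
    (hs : ∀ x, a x ≠ 0 → x ∈ s) :
    R.sobolevNorm a = Real.sqrt (∑ x ∈ s, ((R.rep x).dim : ℝ) *
      (Matrix.trace ((a x).conjTranspose * a x)).re) := by
  refine congrArg Real.sqrt (Finset.sum_subset
    (fun x hx => hs x (DFinsupp.mem_support_iff.1 hx)) fun x _ hx => ?_)
  rw [DFinsupp.notMem_support_iff.1 hx]
  simp

open scoped ComplexOrder in
lemma trace_conjTranspose_mul_self_re_nonneg {ι : Type*} [Fintype ι] (m : Matrix ι ι ℂ) :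
    0 ≤ (Matrix.trace (m.conjTranspose * m)).re :=
  (Complex.le_def.1 (Matrix.posSemidef_conjTranspose_mul_self m).trace_nonneg).1

lemma sobolevNorm_nonneg (a : R.Cc) : 0 ≤ R.sobolevNorm a := Real.sqrt_nonneg _

open Classical in
lemma sobolevNorm_sq_of_subset (a : R.Cc) {s : Finset H.Irr} (hs : ∀ x, a x ≠ 0 → x ∈ s) :
    R.sobolevNorm a ^ 2 = ∑ x ∈ s, ((R.rep x).dim : ℝ) *
      (Matrix.trace ((a x).conjTranspose * a x)).re := by
  rw [R.sobolevNorm_eq_sqrt_sum_of_subset a hs, Real.sq_sqrt]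
  exact Finset.sum_nonneg fun x _ =>
    mul_nonneg (Nat.cast_nonneg _) (trace_conjTranspose_mul_self_re_nonneg _)

/-- Automorphisms act on `c_c(ℍ^)` by isometries for the Sobolev-0-norm, compatibly with the
Fourier transform and with the action on `Irr(ℍ)`. -/
lemma exists_transport (θ : H.aut) (a : R.Cc) :
    ∃ b : R.Cc, R.fourier b = (θ : A ≃⋆ₐ[ℂ] A) (R.fourier a) ∧
      R.sobolevNorm b = R.sobolevNorm a ∧ ∀ y, b y ≠ 0 → a (irrMap θ⁻¹ y) ≠ 0 := by
  classical
  choose S hS hint using R.exists_unitary_intertwiner θ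
  -- The block of `b` at `y` is the block of `a` at `θ⁻¹_* y`, carried to the space of `u^y` by the
  -- intertwiner `S y`.
  let b : R.Cc := (a.comapDomain (irrMap θ⁻¹) (irrEquiv θ).symm.injective).mapRange
    (fun y m => S y * m * (S y).conjTranspose) fun y => by simp
  have hb : ∀ y, b y = S y * a (irrMap θ⁻¹ y) * (S y).conjTranspose := fun y => rfl
  have hsupp : ∀ y, b y ≠ 0 → a (irrMap θ⁻¹ y) ≠ 0 := fun y hy h => hy (by
    rw [hb, h, Matrix.mul_zero, Matrix.zero_mul])
  have ha : ∀ x, a x ≠ 0 → x ∈ a.support := fun x => DFinsupp.mem_support_iff.2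
  have hbs : ∀ y, b y ≠ 0 → y ∈ a.support.map (irrEquiv θ).toEmbedding := fun y hy =>
    Finset.mem_map.2 ⟨irrMap θ⁻¹ y, ha _ (hsupp y hy), (irrEquiv θ).right_inv y⟩
  refine ⟨b, ?_, ?_, hsupp⟩
  · rw [R.fourier_eq_sum_of_subset b hbs, R.fourier_eq_sum_of_subset a ha, map_sum,
      ← sum_map_irrEquiv θ a.support]
    refine Finset.sum_congr rfl fun y _ => ?_
    rw [map_smul, ← trace_map_starAlgEquiv, Matrix.map_mul, scalarMatrix_map, hb,
      trace_mul_conj_of_isIntertwiner (hS y) (hint y)]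
    -- Only the dimension factors still differ.
    exact congrArg (fun n : ℕ => (n : ℂ) • _) (R.dim_rep_irrMap_inv θ y).symm
  · rw [R.sobolevNorm_eq_sqrt_sum_of_subset b hbs, R.sobolevNorm_eq_sqrt_sum_of_subset a ha,
      ← sum_map_irrEquiv θ a.support]
    refine congrArg Real.sqrt (Finset.sum_congr rfl fun y _ => ?_)
    rw [hb, trace_conjTranspose_mul_self_conj (hS y)]
    exact congrArg (fun n : ℕ => (n : ℝ) * _) (R.dim_rep_irrMap_inv θ y).symm

/-! ### Rapid decay estimates -/

variable {R} {l : H.Irr → ℝ} {P : Polynomial ℝ}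

lemma mem_range_cutoff_iff {k : ℕ} {a : R.Cc} :
    a ∈ Set.range (R.cutoff l k) ↔ ∀ x, a x ≠ 0 → l x < k + 1 := by
  classical
  constructor
  · rintro ⟨a, rfl⟩ x hx
    by_contra h
    exact hx (by simp [cutoff, DFinsupp.filter_apply, h])
  · intro h
    refine ⟨a, DFinsupp.ext fun x => ?_⟩
    rw [cutoff, DFinsupp.filter_apply]
    split_ifs with hx
    · rfl
    · by_contra h'
      exact hx (h x (Ne.symm h'))

/-- The unit of the trivial block lies in every cutoff, as `l` vanishes there, and has positive
Sobolev norm; the bound for it forces the sign of `P(k)`. -/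
lemma RapidDecayBound.eval_nonneg (hP : R.RapidDecayBound l P) (hl : IsLengthFunction l)
    (k : ℕ) : 0 ≤ P.eval (k : ℝ) := by
  classical
  set x := H.trivialRep.cls
  let a : R.Cc := DFinsupp.single x 1
  have ha : ∀ y, a y ≠ 0 → y ∈ ({x} : Finset H.Irr) := fun y hy => by
    by_contra h
    exact hy (DFinsupp.single_eq_of_ne (by simpa using h))
  have hmem : a ∈ Set.range (R.cutoff l k) := mem_range_cutoff_iff.2 fun y hy => by
    rw [Finset.mem_singleton.1 (ha y hy), hl.trivial]
    positivity
  have hdim : (0 : ℝ) < (R.rep x).dim := by exact_mod_cast (R.rep x).dim_pos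
  have hnorm : 0 < R.sobolevNorm a := by
    rw [R.sobolevNorm_eq_sqrt_sum_of_subset a ha]
    simpa [a] using hdim
  exact nonneg_of_mul_nonneg_left ((norm_nonneg _).trans (hP k a hmem)) hnorm

/-- The bound for elements supported on `{x | l (θ_* x) < k + 1}`. -/
lemma RapidDecayBound.norm_fourier_le (hP : R.RapidDecayBound l P) (θ : H.aut) {k : ℕ}
    {a : R.Cc} (ha : ∀ x, a x ≠ 0 → l (irrMap θ x) < k + 1) :
    ‖R.fourier a‖ ≤ P.eval (k : ℝ) * R.sobolevNorm a := by
  obtain ⟨b, hb, hn, hs⟩ := R.exists_transport θ a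
  -- An injective ⋆-homomorphism of C⋆-algebras is isometric, so `a` may be replaced by its
  -- transport `b`.
  rw [← hn, ← NonUnitalStarAlgHom.norm_map (θ : A ≃⋆ₐ[ℂ] A) (θ : A ≃⋆ₐ[ℂ] A).injective, ← hb]
  refine hP k b (mem_range_cutoff_iff.2 fun y hy => ?_)
  have := ha _ (hs y hy)
  rwa [show irrMap θ (irrMap θ⁻¹ y) = y from (irrEquiv θ).right_inv y] at this

lemma RapidDecayBound.average (hP : R.RapidDecayBound l P) (hl : IsLengthFunction l)
    (Θ : Subgroup H.aut) [Fintype Θ] :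
    R.RapidDecayBound (average Θ l) (Polynomial.C (Real.sqrt (Fintype.card Θ)) * P) := by
  classical
  intro k a ha
  rw [mem_range_cutoff_iff] at ha
  have hex : ∀ x, ∃ θ : Θ, a x ≠ 0 → l (irrMap θ.1 x) < k + 1 := fun x => by
    by_cases hx : a x = 0
    · exact ⟨1, fun h => absurd hx h⟩
    · obtain ⟨θ, h⟩ := exists_lt_of_average_lt Θ (ha x hx)
      exact ⟨θ, fun _ => h⟩
  choose g hg using hex
  -- Cutting along the fibres of `g` gives disjoint supports, so both the Fourier transform and the
  -- squared norm are additive over the pieces.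
  let c : Θ → R.Cc := fun θ => a.filter fun x => g x = θ
  have hc : ∀ θ x, c θ x ≠ 0 → g x = θ ∧ a x ≠ 0 := fun θ x hx => by
    simp only [c, DFinsupp.filter_apply] at hx
    split_ifs at hx with h
    · exact ⟨h, hx⟩
    · exact absurd rfl hx
  have hc' : ∀ θ x, x ∈ a.support.filter (fun x => g x = θ) → c θ x = a x := fun θ x hx => by
    simp [c, DFinsupp.filter_apply, (Finset.mem_filter.1 hx).2]
  have hsub : ∀ θ x, c θ x ≠ 0 → x ∈ a.support.filter (fun x => g x = θ) := fun θ x hx =>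
    Finset.mem_filter.2 ⟨DFinsupp.mem_support_iff.2 (hc θ x hx).2, (hc θ x hx).1⟩
  have ha' : ∀ x, a x ≠ 0 → x ∈ a.support := fun x => DFinsupp.mem_support_iff.2
  have hF : R.fourier a = ∑ θ, R.fourier (c θ) := by
    rw [R.fourier_eq_sum_of_subset a ha', ← Finset.sum_fiberwise a.support g]
    refine Finset.sum_congr rfl fun θ _ => ?_
    rw [R.fourier_eq_sum_of_subset (c θ) (hsub θ)]
    exact Finset.sum_congr rfl fun x hx => by rw [hc' θ x hx]
  have hN : R.sobolevNorm a ^ 2 = ∑ θ, R.sobolevNorm (c θ) ^ 2 := by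
    rw [R.sobolevNorm_sq_of_subset a ha', ← Finset.sum_fiberwise a.support g]
    refine Finset.sum_congr rfl fun θ _ => ?_
    rw [R.sobolevNorm_sq_of_subset (c θ) (hsub θ)]
    exact Finset.sum_congr rfl fun x hx => by rw [hc' θ x hx]
  -- Cauchy–Schwarz against the constant function 1 on `Θ`: the source of `√|Θ|`.
  have hCS : ∑ θ, R.sobolevNorm (c θ) ≤ Real.sqrt (Fintype.card Θ) * R.sobolevNorm a := by
    refine le_of_sq_le_sq ?_ (mul_nonneg (Real.sqrt_nonneg _) (R.sobolevNorm_nonneg a))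
    rw [mul_pow, Real.sq_sqrt (Nat.cast_nonneg _), hN]
    exact sq_sum_le_card_mul_sum_sq
  calc ‖R.fourier a‖ ≤ ∑ θ, ‖R.fourier (c θ)‖ := hF ▸ norm_sum_le _ _
    _ ≤ ∑ θ, P.eval (k : ℝ) * R.sobolevNorm (c θ) := by
        refine Finset.sum_le_sum fun θ _ => hP.norm_fourier_le θ.1 fun x hx => ?_
        obtain ⟨h, hx⟩ := hc θ x hx
        exact h ▸ hg x hx
    _ = P.eval (k : ℝ) * ∑ θ, R.sobolevNorm (c θ) := (Finset.mul_sum _ _ _).symm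
    _ ≤ P.eval (k : ℝ) * (Real.sqrt (Fintype.card Θ) * R.sobolevNorm a) :=
        mul_le_mul_of_nonneg_left hCS (hP.eval_nonneg hl k)
    _ = _ := by rw [Polynomial.eval_mul, Polynomial.eval_C]; ring

end Representatives

end CompactQuantumGroup

theorem mainTheorem6 {A : Type*} [CStarAlgebra A] (H : CompactQuantumGroup A) (hKac : H.IsKac)
    (R : H.Representatives) (Θ : Subgroup H.aut) [Fintype Θ] :
    ((∃ (l : H.Irr → ℝ) (P : Polynomial ℝ),
        CompactQuantumGroup.IsLengthFunction l ∧ R.RapidDecayBound l P) ↔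
      ∃ (l : H.Irr → ℝ) (Q : Polynomial ℝ),
        CompactQuantumGroup.IsLengthFunction l ∧ CompactQuantumGroup.IsInvariant Θ l ∧
          R.RapidDecayBound l Q) ∧
    ∀ (l : H.Irr → ℝ) (P : Polynomial ℝ),
      CompactQuantumGroup.IsLengthFunction l → R.RapidDecayBound l P →
        CompactQuantumGroup.IsLengthFunction (CompactQuantumGroup.average Θ l) ∧
        CompactQuantumGroup.IsInvariant Θ (CompactQuantumGroup.average Θ l) ∧
        R.RapidDecayBound (CompactQuantumGroup.average Θ l)
          (Polynomial.C (Real.sqrt (Fintype.card Θ)) * P) := by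
  have main : ∀ (l : H.Irr → ℝ) (P : Polynomial ℝ),
      CompactQuantumGroup.IsLengthFunction l → R.RapidDecayBound l P →
        CompactQuantumGroup.IsLengthFunction (CompactQuantumGroup.average Θ l) ∧
        CompactQuantumGroup.IsInvariant Θ (CompactQuantumGroup.average Θ l) ∧
        R.RapidDecayBound (CompactQuantumGroup.average Θ l)
          (Polynomial.C (Real.sqrt (Fintype.card Θ)) * P) := fun l P hl hP =>
    ⟨hl.average Θ, CompactQuantumGroup.isInvariant_average Θ l, hP.average hl Θ⟩
  exact ⟨⟨fun ⟨l, P, hl, hP⟩ => ⟨_, _, main l P hl hP⟩,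
    fun ⟨l, Q, hl, _, hQ⟩ => ⟨l, Q, hl, hQ⟩⟩, main⟩
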